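/- Let $M_N(\mathbb C)$ carry the Hilbert–Schmidt inner product $\langle A,B\rangle=\operatorname{Tr}(A^*B)$, let $M_N^0(\mathbb C)$ be its subspace of traceless matrices, and let $P$ be the orthogonal projection of $M_N(\mathbb C)$ onto $M_N^0(\mathbb C)$. A quantum dynamical semigroup (QDS) on $M_N(\mathbb C)$ is a family $(T_t)_{t\ge 0}$ of completely positive, trace-preserving linear maps on $M_N(\mathbb C)$ with $T_0=\mathrm{id}$, $T_{t+s}=T_tT_s$ for all $t,s\ge 0$, and $t\mapsto T_t(A)$ continuous for every $A$; its generator is $\mathcal L(A)=\lim_{t\downarrow 0}\frac1t(T_t(A)-A)$. Let $\{F_i \mid 1\le i\le N^2\}$ be a set of $N\times N$ complex matrices that is orthonormal with respect to the Hilbert–Schmidt inner product (the $F_i$ need not be traceless). A linear operator $\mathcal L:M_N(\mathbb C)\to M_N(\mathbb C)$ is the generator of a QDS on $M_N(\mathbb C)$ if and only if it can be expressed in the form $$\mathcal L(\rho)=-i[\widetilde H,\rho]+\frac12\sum_{i,j=1}^{N^2}\gamma_{ij}\big([F_i,\rho F_j^*]+[F_i\rho,F_j^*]\big),$$ with $\widetilde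 H$ Hermitian and $\Gamma=(\gamma_{ij})$ an $N^2\times N^2$ complex matrix which, regarded as the operator on $M_N(\mathbb C)$ given by $\Gamma(F_j)=\sum_i\gamma_{ij}F_i$, satisfies 1. $P\Gamma|_{M_N^0(\mathbb C)}\ge 0$ (positive semidefinite as an operator on $M_N^0(\mathbb C)$), and 2. $\operatorname{Re}\operatorname{Tr}(\Gamma(A))=\operatorname{Re}\operatorname{Tr}(\Gamma(I_N)A)$ for all Hermitian $A\in M_N(\mathbb C)$. The operator $P\Gamma|_{M_N^0(\mathbb C)}$ is uniquely determined by $\mathcal L$: any two such representations of $\mathcal L$, even with respect to different orthonormal sets $\{F_i\}$ and $\{F_i'\}$, give the same operator. Conditions 1 and 2 are satisfied whenever the matrix $\Gamma$ is positive semidefinite. -/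

import Mathlib

open scoped NNReal Topology ComplexOrder

/-- `N × N` complex matrices. -/
abbrev MatN (N : ℕ) : Type := Matrix (Fin N) (Fin N) ℂ

/-- A linear map `T` on `M_N(ℂ)` is completely positive if for every `k` its ampliation
`id_k ⊗ T` to `k × k` block matrices with blocks in `M_N(ℂ)` preserves positive semidefiniteness.
(`Matrix.comp` turns a matrix of blocks into an ordinary matrix, and `X.map T` applies `T` to
each block.) -/
def IsCompletelyPositive {N : ℕ} (T : MatN N →ₗ[ℂ] MatN N) : Prop :=
  ∀ (k : ℕ) (X : Matrix (Fin k) (Fin k) (MatN N)),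
    (Matrix.comp (Fin k) (Fin k) (Fin N) (Fin N) ℂ X).PosSemidef →
    (Matrix.comp (Fin k) (Fin k) (Fin N) (Fin N) ℂ (X.map T)).PosSemidef

/-- Quantum dynamical semigroups on `M_N(ℂ)` in the Schrödinger picture. The topology on matrices
is that of entrywise convergence, which is the weak (and the norm) topology of `M_N(ℂ)`. -/
structure IsQDS {N : ℕ} (T : ℝ≥0 → (MatN N →ₗ[ℂ] MatN N)) : Prop where
  map_zero : T 0 = LinearMap.id
  map_add : ∀ t s : ℝ≥0, T (t + s) = T t ∘ₗ T s
  continuous : ∀ A : MatN N, Continuous fun t : ℝ≥0 => T t A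
  trace_preserving : ∀ (t : ℝ≥0) (A : MatN N), (T t A).trace = A.trace
  completelyPositive : ∀ t : ℝ≥0, IsCompletelyPositive (T t)

/-- `L` is the generator of the family `T`: `L(A) = lim_{t ↓ 0} (T_t(A) - A) / t` for all `A`. -/
def IsGeneratorOf {N : ℕ} (L : MatN N →ₗ[ℂ] MatN N) (T : ℝ≥0 → (MatN N →ₗ[ℂ] MatN N)) : Prop :=
  ∀ A : MatN N,
    Filter.Tendsto (fun t : ℝ≥0 => ((t : ℝ)⁻¹ : ℝ) • (T t A - A)) (𝓝[>] (0 : ℝ≥0)) (𝓝 (L A))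

/-- `L` is the generator of some quantum dynamical semigroup on `M_N(ℂ)`. -/
def IsQDSGenerator {N : ℕ} (L : MatN N →ₗ[ℂ] MatN N) : Prop :=
  ∃ T : ℝ≥0 → (MatN N →ₗ[ℂ] MatN N), IsQDS T ∧ IsGeneratorOf L T

/-- The right-hand side of the GKSL form with Hamiltonian `H` and coefficient matrix `γ`:
`-i[H, ρ] + ½ ∑_{i,j} γ_{ij} ([F_i, ρ F_j^*] + [F_i ρ, F_j^*])`. -/
noncomputable def gkslForm {N : ℕ} (F : Fin (N ^ 2) → MatN N) (H : MatN N)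
    (γ : Matrix (Fin (N ^ 2)) (Fin (N ^ 2)) ℂ) (ρ : MatN N) : MatN N :=
  -Complex.I • ⁅H, ρ⁆ +
    (1 / 2 : ℂ) • ∑ i, ∑ j,
      γ i j • (⁅F i, ρ * (F j).conjTranspose⁆ + ⁅F i * ρ, (F j).conjTranspose⁆)

/-- The space of traceless matrices. -/
noncomputable def traceless (N : ℕ) : Submodule ℂ (MatN N) :=
  LinearMap.ker (Matrix.traceLinearMap (Fin N) ℂ ℂ)

attribute [local instance] Matrix.frobeniusNormedAddCommGroup Matrix.frobeniusNormedSpace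

/-- The Hilbert–Schmidt inner product `⟪A, B⟫ = Tr(A^* B)` on `M_N(ℂ)`, whose norm is the
Hilbert–Schmidt (Frobenius) norm. -/
noncomputable instance hilbertSchmidt (N : ℕ) : InnerProductSpace ℂ (MatN N) where
  inner A B := (A.conjTranspose * B).trace
  norm_sq_eq_re_inner A := by
    have h : ‖A‖ ^ 2 = ∑ i, ∑ j, ‖A i j‖ ^ 2 := by
      rw [Matrix.frobenius_norm_def, ← Real.sqrt_eq_rpow, Real.sq_sqrt (by positivity)]
      simp
    rw [h, Finset.sum_comm]
    simp [Matrix.trace, Matrix.mul_apply, ← Complex.normSq_eq_conj_mul_self,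
      Complex.normSq_eq_norm_sq]
    exact Finset.sum_congr rfl fun i _ => Finset.sum_congr rfl fun j _ => by norm_cast
  conj_inner_symm A B := by
    rw [starRingEnd_apply, ← Matrix.trace_conjTranspose]
    simp
  add_left A B C := by simp [add_mul]
  smul_left A B r := by simp

/-- The matrix `γ` regarded as an operator on `M_N(ℂ)` equipped with the orthonormal basis `F`,
so that `F_j ↦ ∑_i γ_{ij} F_i`. -/
noncomputable def coeffOperator {N : ℕ} (F : Fin (N ^ 2) → MatN N)
    (γ : Matrix (Fin (N ^ 2)) (Fin (N ^ 2)) ℂ) : MatN N →ₗ[ℂ] MatN N where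
  toFun A := ∑ i, ∑ j, (γ i j * inner ℂ (F j) A) • F i
  map_add' A B := by simp [mul_add, add_smul, Finset.sum_add_distrib]
  map_smul' r A := by
    simp only [inner_smul_right, Finset.smul_sum, smul_smul, RingHom.id_apply]
    exact Finset.sum_congr rfl fun i _ => Finset.sum_congr rfl fun j _ => by ring_nf

/-- The compression `P G|_{M_N^0}` of an operator `G` on `M_N(ℂ)` to the traceless matrices, where
`P` is the orthogonal projection of `M_N(ℂ)` onto them. -/
noncomputable def tracelessCompression {N : ℕ} (G : MatN N →ₗ[ℂ] MatN N) :
    traceless N →ₗ[ℂ] traceless N :=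
  (traceless N).orthogonalProjectionOnto.toLinearMap ∘ₗ G ∘ₗ (traceless N).subtype

/-- The two conditions on a coefficient operator `G`: its compression to the traceless matrices is
positive semidefinite, and `Re Tr(G(A)) = Re Tr(G(I) A)` for all Hermitian `A`. -/
structure IsAdmissible {N : ℕ} (G : MatN N →ₗ[ℂ] MatN N) : Prop where
  compression_nonneg : (tracelessCompression G).IsPositive
  re_trace_eq : ∀ A : MatN N, A.IsHermitian → (G A).trace.re = (G 1 * A).trace.re

/-- `L` is in GKSL form with respect to `F`, with Hermitian `H` and a coefficient matrix `γ` that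
satisfies the two conditions. -/
structure IsGKSLRepresentation {N : ℕ} (F : Fin (N ^ 2) → MatN N) (L : MatN N →ₗ[ℂ] MatN N)
    (H : MatN N) (γ : Matrix (Fin (N ^ 2)) (Fin (N ^ 2)) ℂ) : Prop where
  hermitian : H.IsHermitian
  eq_form : ∀ ρ : MatN N, L ρ = gkslForm F H γ ρ
  admissible : IsAdmissible (coeffOperator F γ)

/-! The proof runs on the linear involution R = `reshuffle` of operators on `MatN N`, which
exchanges ρ ↦ X ρ Y^* with |X⟩⟨Y|. By Choi's theorem (`isCompletelyPositive_iff`), T is completely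
positive iff R(T) ≥ 0. By `gkslForm_eq` the GKSL form depends on F and γ only through G =
`coeffOperator F γ`, and R turns L into G + |K⟩⟨1| + |1⟩⟨K'|. The last two terms vanish between
traceless matrices, so R(L) determines the compression of G.

For a generator, R(L) is the limit of (R(T_t) - |1⟩⟨1|)/t. It is therefore symmetric, and
nonnegative on 1^⊥, the traceless matrices. As L has trace zero, G = R(L) with H = 0 already
represents L.

Conversely, split G along 1 and 1^⊥. The part on 1^⊥ is positive by condition 1, and condition 2
says exactly that the mixed terms contribute a Hamiltonian commutator. Hence L(ρ) = Φ(ρ) + Kρ + ρK^*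
with Φ completely positive, and `isCompletelyPositive_exp_of_dissipation` shows that exp(tL) is
completely positive. -/

/-! ### Rank one operators and reshuffling -/

/-- The rank one operator `A ↦ ⟪Y, A⟫ X`. -/
noncomputable def ketbra {N : ℕ} (X Y : MatN N) : Module.End ℂ (MatN N) :=
  (innerₛₗ ℂ Y : MatN N →ₗ[ℂ] ℂ).smulRight X

theorem ketbra_apply {N : ℕ} (X Y A : MatN N) : ketbra X Y A = inner ℂ Y A • X := rfl

theorem hilbertSchmidt_inner_def {N : ℕ} (A B : MatN N) :
    inner ℂ A B = (A.conjTranspose * B).trace := rfl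

theorem inner_single_left {N : ℕ} (a k : Fin N) (B : MatN N) :
    inner ℂ (Matrix.single a k (1 : ℂ)) B = B a k := by
  simp [hilbertSchmidt_inner_def, Matrix.conjTranspose_single, Matrix.trace_single_mul]

theorem inner_single_right {N : ℕ} (a k : Fin N) (B : MatN N) :
    inner ℂ B (Matrix.single a k (1 : ℂ)) = star (B a k) := by
  rw [← inner_conj_symm, inner_single_left]; rfl

theorem inner_eq_sum {N : ℕ} (A B : MatN N) :
    inner ℂ A B = ∑ a, ∑ k, star (A a k) * B a k := by
  rw [hilbertSchmidt_inner_def, Finset.sum_comm]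
  simp [Matrix.trace, Matrix.mul_apply]

/-- The linear involution on operators on `M_N(ℂ)` that exchanges `ρ ↦ X ρ Y^*` with the rank one
operator `A ↦ ⟪Y, A⟫ X`. -/
noncomputable def reshuffle (N : ℕ) : Module.End ℂ (MatN N) →ₗ[ℂ] Module.End ℂ (MatN N) where
  toFun G :=
    { toFun := fun ρ => Matrix.of fun a b => ∑ k, ∑ l, G (Matrix.single b l 1) a k * ρ k l
      map_add' := fun ρ σ => by
        ext a b
        simp [mul_add, Finset.sum_add_distrib]
      map_smul' := fun r ρ => by
        ext a b
        simp [Finset.mul_sum, mul_left_comm] }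
  map_add' G G' := by
    ext ρ a b
    simp [add_mul, Finset.sum_add_distrib]
  map_smul' r G := by
    ext ρ a b
    simp [Finset.mul_sum, mul_assoc]

theorem reshuffle_apply {N : ℕ} (G : Module.End ℂ (MatN N)) (ρ : MatN N) (a b : Fin N) :
    reshuffle N G ρ a b = ∑ k, ∑ l, G (Matrix.single b l 1) a k * ρ k l := rfl

theorem reshuffle_single {N : ℕ} (G : Module.End ℂ (MatN N)) (a b k l : Fin N) :
    reshuffle N G (Matrix.single k l 1) a b = G (Matrix.single b l 1) a k := by
  rw [reshuffle_apply, Finset.sum_eq_single k, Finset.sum_eq_single l]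
  · simp
  · intro c _ hc; simp [hc.symm]
  · simp
  · intro c _ hc; simp [hc.symm]
  · simp

theorem apply_eq_sum_single {N : ℕ} (G : Module.End ℂ (MatN N)) (ρ : MatN N) (a b : Fin N) :
    G ρ a b = ∑ k, ∑ l, G (Matrix.single k l 1) a b * ρ k l := by
  conv_lhs => rw [Matrix.matrix_eq_sum_single ρ]
  simp only [map_sum, Matrix.sum_apply]
  refine Finset.sum_congr rfl fun k _ => Finset.sum_congr rfl fun l _ => ?_
  have : Matrix.single k l (ρ k l) = ρ k l • (Matrix.single k l (1 : ℂ) : MatN N) := by simp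
  rw [this, map_smul, Matrix.smul_apply, smul_eq_mul, mul_comm]

/-- In the coordinates G(E_kl)_ab, reshuffling is the swap of b and k. -/
theorem reshuffle_reshuffle {N : ℕ} (G : Module.End ℂ (MatN N)) :
    reshuffle N (reshuffle N G) = G := by
  ext1 ρ
  ext a b
  rw [reshuffle_apply, apply_eq_sum_single]
  simp only [reshuffle_single]

theorem reshuffle_ketbra_apply {N : ℕ} (X Y ρ : MatN N) :
    reshuffle N (ketbra X Y) ρ = X * ρ * Y.conjTranspose := by
  ext a b
  simp only [reshuffle_apply, ketbra_apply, inner_single_right, Matrix.smul_apply,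
    Matrix.mul_apply, Matrix.conjTranspose_apply, Finset.sum_mul, smul_eq_mul]
  rw [Finset.sum_comm]
  exact Finset.sum_congr rfl fun l _ => Finset.sum_congr rfl fun k _ => by ring

theorem reshuffle_ketbra_one_one (N : ℕ) : reshuffle N (ketbra 1 1) = LinearMap.id := by
  ext1 ρ
  simp [reshuffle_ketbra_apply]

/-! ### Contraction, traces and the GKSL form -/

/-- The linear map from operators to matrices that sends `A ↦ ⟪Y, A⟫ X` to `Y^* X`. -/
noncomputable def contraction (N : ℕ) : Module.End ℂ (MatN N) →ₗ[ℂ] MatN N where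
  toFun G := Matrix.of fun l k => ∑ a, G (Matrix.single a l 1) a k
  map_add' G G' := by
    ext l k
    simp [Finset.sum_add_distrib]
  map_smul' r G := by
    ext l k
    simp [Finset.mul_sum]

theorem contraction_apply {N : ℕ} (G : Module.End ℂ (MatN N)) (l k : Fin N) :
    contraction N G l k = ∑ a, G (Matrix.single a l 1) a k := rfl

theorem contraction_ketbra {N : ℕ} (X Y : MatN N) :
    contraction N (ketbra X Y) = Y.conjTranspose * X := by
  ext l k
  simp only [contraction_apply, ketbra_apply, inner_single_right, Matrix.smul_apply,
    Matrix.mul_apply, Matrix.conjTranspose_apply, smul_eq_mul]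

/-- For G = |X⟩⟨Y| this is Tr(X ρ Y^*) = Tr(Y^* X ρ). -/
theorem trace_reshuffle {N : ℕ} (G : Module.End ℂ (MatN N)) (ρ : MatN N) :
    (reshuffle N G ρ).trace = (contraction N G * ρ).trace := by
  simp only [Matrix.trace, Matrix.diag_apply, reshuffle_apply, Matrix.mul_apply,
    contraction_apply, Finset.sum_mul]
  rw [Finset.sum_comm]
  conv_rhs => rw [Finset.sum_comm]
  exact Finset.sum_congr rfl fun k _ => Finset.sum_comm

theorem contraction_isHermitian {N : ℕ} {G : Module.End ℂ (MatN N)} (hG : G.IsSymmetric) :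
    (contraction N G).IsHermitian := by
  ext l k
  simp only [Matrix.conjTranspose_apply, contraction_apply, star_sum]
  refine Finset.sum_congr rfl fun a _ => ?_
  rw [← inner_single_right, hG, inner_single_left]

theorem coeffOperator_eq_sum {N : ℕ} (F : Fin (N ^ 2) → MatN N)
    (γ : Matrix (Fin (N ^ 2)) (Fin (N ^ 2)) ℂ) :
    coeffOperator F γ = ∑ i, ∑ j, γ i j • ketbra (F i) (F j) := by
  ext1 A
  simp [coeffOperator, ketbra_apply, smul_smul]

theorem gkslForm_eq {N : ℕ} (F : Fin (N ^ 2) → MatN N) (H : MatN N)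
    (γ : Matrix (Fin (N ^ 2)) (Fin (N ^ 2)) ℂ) (ρ : MatN N) :
    gkslForm F H γ ρ = -Complex.I • (H * ρ - ρ * H) + reshuffle N (coeffOperator F γ) ρ -
      (1 / 2 : ℂ) • (contraction N (coeffOperator F γ) * ρ +
        ρ * contraction N (coeffOperator F γ)) := by
  have h (i j : Fin (N ^ 2)) :
      ⁅F i, ρ * (F j).conjTranspose⁆ + ⁅F i * ρ, (F j).conjTranspose⁆ =
        (2 : ℂ) • (F i * ρ * (F j).conjTranspose) -
          ((F j).conjTranspose * F i * ρ + ρ * ((F j).conjTranspose * F i)) := by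
    rw [Ring.lie_def, Ring.lie_def, two_smul]
    noncomm_ring
  simp only [gkslForm, h]
  simp only [coeffOperator_eq_sum, map_sum, map_smul, LinearMap.sum_apply,
    LinearMap.smul_apply, reshuffle_ketbra_apply, contraction_ketbra, Ring.lie_def,
    Finset.sum_mul, Finset.mul_sum, smul_sub, smul_add, Finset.sum_sub_distrib,
    Finset.sum_add_distrib, Matrix.smul_mul, Matrix.mul_smul]
  simp only [Finset.smul_sum, smul_smul, add_sub_assoc]
  congr 2
  refine Finset.sum_congr rfl fun l _ => Finset.sum_congr rfl fun k _ => ?_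
  congr 1
  ring

/-- N² orthonormal matrices form a basis, so γ can be the matrix of G in it. -/
theorem exists_eq_coeffOperator {N : ℕ} {F : Fin (N ^ 2) → MatN N} (hF : Orthonormal ℂ F)
    (G : Module.End ℂ (MatN N)) : ∃ γ, G = coeffOperator F γ := by
  have hcard : Fintype.card (Fin (N ^ 2)) = Module.finrank ℂ (MatN N) := by
    simp [Module.finrank_matrix, sq]
  let b : OrthonormalBasis (Fin (N ^ 2)) ℂ (MatN N) :=
    OrthonormalBasis.mk hF (hF.linearIndependent.span_eq_top_of_card_eq_finrank' hcard).ge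
  have hb (i) : b i = F i := by simp [b]
  refine ⟨Matrix.of fun i j => inner ℂ (F i) (G (F j)), ?_⟩
  ext1 A
  have h1 : G A = ∑ i, inner ℂ (b i) (G A) • b i := (b.sum_repr' _).symm
  rw [h1]
  have h2 : A = ∑ i, inner ℂ (b i) A • b i := (b.sum_repr' _).symm
  refine Finset.sum_congr rfl fun i _ => ?_
  conv_lhs => rw [h2, map_sum, inner_sum, Finset.sum_smul]
  refine Finset.sum_congr rfl fun j _ => ?_
  rw [map_smul, inner_smul_right, hb, hb, mul_comm, Matrix.of_apply]

/-! ### Complete positivity and Choi's theorem -/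

theorem isPositive_of_inner_nonneg {E : Type*} [NormedAddCommGroup E] [InnerProductSpace ℂ E]
    {G : E →ₗ[ℂ] E} (h : ∀ Y : E, 0 ≤ inner ℂ Y (G Y)) : G.IsPositive := by
  rw [LinearMap.isPositive_iff_complex]
  intro Y
  have hY := Complex.nonneg_iff.1 (h Y)
  have e : inner ℂ (G Y) Y = starRingEnd ℂ (inner ℂ Y (G Y)) := (inner_conj_symm _ _).symm
  rw [e]
  generalize inner ℂ Y (G Y) = z at hY
  exact ⟨Complex.ext (by simp) (by simp [← hY.2]), by simpa using hY.1⟩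

theorem ketbra_self_isPositive {N : ℕ} (X : MatN N) : (ketbra X X).IsPositive := by
  refine isPositive_of_inner_nonneg fun Y => ?_
  rw [ketbra_apply, inner_smul_right, ← inner_conj_symm Y X, mul_comm]
  exact star_mul_self_nonneg (inner ℂ X Y)

theorem IsCompletelyPositive.id (N : ℕ) :
    IsCompletelyPositive (LinearMap.id : MatN N →ₗ[ℂ] MatN N) := fun _ _ hX => hX

theorem IsCompletelyPositive.comp {N : ℕ} {S T : MatN N →ₗ[ℂ] MatN N}
    (hS : IsCompletelyPositive S) (hT : IsCompletelyPositive T) :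
    IsCompletelyPositive (S ∘ₗ T) := fun k _ hX => hS k _ (hT k _ hX)

theorem IsCompletelyPositive.add {N : ℕ} {S T : MatN N →ₗ[ℂ] MatN N}
    (hS : IsCompletelyPositive S) (hT : IsCompletelyPositive T) :
    IsCompletelyPositive (S + T) := fun k X hX => (hS k X hX).add (hT k X hX)

theorem IsCompletelyPositive.zero (N : ℕ) :
    IsCompletelyPositive (0 : MatN N →ₗ[ℂ] MatN N) := fun _ _ _ => Matrix.PosSemidef.zero

theorem IsCompletelyPositive.smul {N : ℕ} {T : MatN N →ₗ[ℂ] MatN N}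
    (hT : IsCompletelyPositive T) {c : ℂ} (hc : 0 ≤ c) :
    IsCompletelyPositive (c • T) := fun k X hX => (hT k X hX).smul hc

theorem IsCompletelyPositive.sum {N : ℕ} {ι : Type*} (s : Finset ι)
    {T : ι → (MatN N →ₗ[ℂ] MatN N)} (hT : ∀ i ∈ s, IsCompletelyPositive (T i)) :
    IsCompletelyPositive (∑ i ∈ s, T i) :=
  Finset.sum_induction _ _ (fun _ _ => .add) (.zero N) hT

theorem IsCompletelyPositive.pow {N : ℕ} {T : Module.End ℂ (MatN N)}
    (hT : IsCompletelyPositive T) (n : ℕ) : IsCompletelyPositive (T ^ n) := by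
  induction n with
  | zero => exact .id N
  | succ n ih => rw [pow_succ]; exact ih.comp hT

open scoped Kronecker in
theorem isCompletelyPositive_reshuffle_ketbra {N : ℕ} (V : MatN N) :
    IsCompletelyPositive (reshuffle N (ketbra V V)) := by
  intro k X hX
  have h : Matrix.comp (Fin k) (Fin k) (Fin N) (Fin N) ℂ (X.map (reshuffle N (ketbra V V))) =
      ((1 : Matrix (Fin k) (Fin k) ℂ) ⊗ₖ V) * Matrix.comp (Fin k) (Fin k) (Fin N) (Fin N) ℂ X *
        ((1 : Matrix (Fin k) (Fin k) ℂ) ⊗ₖ V).conjTranspose := by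
    ext ⟨p, a⟩ ⟨q, b⟩
    simp only [Matrix.comp_apply, Matrix.map_apply, reshuffle_ketbra_apply, Matrix.mul_apply,
      Matrix.conjTranspose_apply, Fintype.sum_prod_type, Matrix.kroneckerMap_apply,
      Matrix.one_apply]
    conv_rhs => rw [Finset.sum_comm]
    simp [apply_ite (starRingEnd ℂ)]
  rw [h]
  exact hX.mul_mul_conjTranspose_same _

/-- The spectral theorem; after reshuffling, this is a Kraus decomposition. -/
theorem LinearMap.IsPositive.exists_eq_sum_ketbra {N : ℕ} {G : Module.End ℂ (MatN N)}
    (hG : G.IsPositive) : ∃ (n : ℕ) (c : Fin n → ℝ) (V : Fin n → MatN N),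
      (∀ i, 0 ≤ c i) ∧ G = ∑ i, (c i : ℂ) • ketbra (V i) (V i) := by
  refine ⟨_, hG.isSymmetric.eigenvalues rfl, hG.isSymmetric.eigenvectorBasis rfl,
    hG.nonneg_eigenvalues rfl, ?_⟩
  set b := hG.isSymmetric.eigenvectorBasis rfl with hb
  ext1 A
  conv_lhs => rw [← b.sum_repr' A, map_sum]
  simp only [LinearMap.sum_apply, LinearMap.smul_apply, ketbra_apply, map_smul]
  refine Finset.sum_congr rfl fun i _ => ?_
  rw [hb, hG.isSymmetric.apply_eigenvectorBasis, smul_comm]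
  rfl

theorem isCompletelyPositive_reshuffle {N : ℕ} {G : Module.End ℂ (MatN N)}
    (hG : G.IsPositive) : IsCompletelyPositive (reshuffle N G) := by
  obtain ⟨n, c, V, hc, rfl⟩ := hG.exists_eq_sum_ketbra
  rw [map_sum]
  refine .sum _ fun i _ => ?_
  rw [map_smul]
  exact (isCompletelyPositive_reshuffle_ketbra _).smul (by exact_mod_cast hc i)

theorem inner_reshuffle {N : ℕ} (T : Module.End ℂ (MatN N)) (X Y : MatN N) :
    inner ℂ X (reshuffle N T Y) =
      ∑ a, ∑ k, star (X a k) * ∑ p, ∑ q, T (Matrix.single k q 1) a p * Y p q := by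
  simp only [inner_eq_sum, reshuffle_apply]

/-- Complete positivity implies positivity of the Choi operator. -/
theorem IsCompletelyPositive.reshuffle_isPositive {N : ℕ} {T : Module.End ℂ (MatN N)}
    (hT : IsCompletelyPositive T) : (reshuffle N T).IsPositive := by
  refine isPositive_of_inner_nonneg fun Y => ?_
  -- The unnormalised maximally entangled vector: the block matrix of matrix units is w w^*, hence
  -- positive.
  let w : Fin N × Fin N → ℂ := fun p => if p.1 = p.2 then 1 else 0
  let X : Matrix (Fin N) (Fin N) (MatN N) := Matrix.of fun k l => Matrix.single k l 1
  have hX : Matrix.comp (Fin N) (Fin N) (Fin N) (Fin N) ℂ X = Matrix.vecMulVec w (star w) := by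
    ext ⟨k, a⟩ ⟨l, b⟩
    by_cases h : k = a <;> by_cases h' : l = b <;>
      simp [X, w, Matrix.vecMulVec_apply, h, h']
  have h := hT N X (hX ▸ Matrix.posSemidef_vecMulVec_self_star w)
  have h2 := (Matrix.posSemidef_iff_dotProduct_mulVec.1 h).2 fun p => Y p.2 p.1
  refine h2.trans_eq ?_
  rw [inner_reshuffle, Finset.sum_comm]
  simp only [dotProduct, Matrix.mulVec, Fintype.sum_prod_type, Matrix.comp_apply, X,
    Matrix.map_apply, Matrix.of_apply, Pi.star_apply]
  refine Finset.sum_congr rfl fun a _ => Finset.sum_congr rfl fun k _ => ?_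
  rw [Finset.sum_comm]

theorem isCompletelyPositive_iff {N : ℕ} {T : Module.End ℂ (MatN N)} :
    IsCompletelyPositive T ↔ (reshuffle N T).IsPositive :=
  ⟨fun h => h.reshuffle_isPositive,
    fun h => by simpa only [reshuffle_reshuffle] using isCompletelyPositive_reshuffle h⟩

/-! ### Compression to traceless matrices and uniqueness -/

theorem inner_tracelessCompression {N : ℕ} (G : MatN N →ₗ[ℂ] MatN N) (x y : traceless N) :
    inner ℂ x (tracelessCompression G y) = inner ℂ (x : MatN N) (G y) :=
  Submodule.inner_orthogonalProjectionOnto_eq_of_mem_left x (G y)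

theorem mem_traceless {N : ℕ} {A : MatN N} : A ∈ traceless N ↔ A.trace = 0 := Iff.rfl

theorem inner_one_left {N : ℕ} (A : MatN N) : inner ℂ (1 : MatN N) A = A.trace := by
  simp [hilbertSchmidt_inner_def]

theorem inner_one_right {N : ℕ} (A : MatN N) : inner ℂ A (1 : MatN N) = star A.trace := by
  rw [← inner_conj_symm, inner_one_left]; rfl

theorem tracelessCompression_isPositive_iff {N : ℕ} {G : MatN N →ₗ[ℂ] MatN N} :
    (tracelessCompression G).IsPositive ↔
      ∀ Y : MatN N, Y.trace = 0 → 0 ≤ inner ℂ Y (G Y) := by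
  constructor
  · intro h Y hY
    have := h.inner_nonneg_right ⟨Y, mem_traceless.2 hY⟩
    rwa [inner_tracelessCompression] at this
  · intro h
    refine isPositive_of_inner_nonneg fun Y => ?_
    rw [inner_tracelessCompression]
    exact h Y Y.2

/-- Condition 2 holds since Tr G(A) = ⟨1, G A⟩ = ⟨G 1, A⟩, the conjugate of Tr(A G(1)). -/
theorem isAdmissible_of_isSymmetric {N : ℕ} {G : MatN N →ₗ[ℂ] MatN N} (hG : G.IsSymmetric)
    (h : ∀ Y : MatN N, Y.trace = 0 → 0 ≤ inner ℂ Y (G Y)) : IsAdmissible G where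
  compression_nonneg := tracelessCompression_isPositive_iff.2 h
  re_trace_eq A hA := by
    rw [← inner_one_left, ← hG, ← inner_conj_symm, hilbertSchmidt_inner_def, hA.eq,
      Matrix.trace_mul_comm]
    exact Complex.conj_re _

theorem coeffOperator_isPositive {N : ℕ} (F : Fin (N ^ 2) → MatN N)
    {γ : Matrix (Fin (N ^ 2)) (Fin (N ^ 2)) ℂ} (hγ : γ.PosSemidef) :
    (coeffOperator F γ).IsPositive := by
  refine isPositive_of_inner_nonneg fun Y => ?_
  refine ((Matrix.posSemidef_iff_dotProduct_mulVec.1 hγ).2 fun j => inner ℂ (F j) Y).trans_eq ?_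
  simp only [coeffOperator_eq_sum, LinearMap.sum_apply, LinearMap.smul_apply, ketbra_apply,
    inner_sum, inner_smul_right, dotProduct, Matrix.mulVec, Pi.star_apply, Finset.mul_sum]
  refine Finset.sum_congr rfl fun i _ => Finset.sum_congr rfl fun j _ => ?_
  rw [← inner_conj_symm Y (F i), starRingEnd_apply]
  ring

theorem IsAdmissible.of_posSemidef {N : ℕ} (F : Fin (N ^ 2) → MatN N)
    {γ : Matrix (Fin (N ^ 2)) (Fin (N ^ 2)) ℂ} (hγ : γ.PosSemidef) :
    IsAdmissible (coeffOperator F γ) :=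
  isAdmissible_of_isSymmetric (coeffOperator_isPositive F hγ).isSymmetric
    fun Y _ => (coeffOperator_isPositive F hγ).inner_nonneg_right Y

theorem reshuffle_eq_of_eq_gkslForm {N : ℕ} {F : Fin (N ^ 2) → MatN N} {L : MatN N →ₗ[ℂ] MatN N}
    {H : MatN N} {γ : Matrix (Fin (N ^ 2)) (Fin (N ^ 2)) ℂ}
    (h : ∀ ρ, L ρ = gkslForm F H γ ρ) :
    ∃ K K' : MatN N, reshuffle N L = coeffOperator F γ + ketbra K 1 + ketbra 1 K' := by
  set C := contraction N (coeffOperator F γ) with hC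
  -- K multiplies ρ on the left; K' enters as ρ K'^*, whence the adjoint.
  refine ⟨-Complex.I • H - (1 / 2 : ℂ) • C, (Complex.I • H - (1 / 2 : ℂ) • C).conjTranspose, ?_⟩
  rw [← reshuffle_reshuffle (coeffOperator F γ + _ + _)]
  congr 1
  ext1 ρ
  rw [h, gkslForm_eq, ← hC]
  simp only [map_add, LinearMap.add_apply, reshuffle_ketbra_apply, Matrix.conjTranspose_one,
    Matrix.conjTranspose_conjTranspose, mul_one, one_mul, sub_mul, mul_sub, Matrix.smul_mul,
    Matrix.mul_smul]
  module

theorem tracelessCompression_unique {N : ℕ} {F F' : Fin (N ^ 2) → MatN N}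
    {L : MatN N →ₗ[ℂ] MatN N} {H H' : MatN N} {γ γ' : Matrix (Fin (N ^ 2)) (Fin (N ^ 2)) ℂ}
    (h : ∀ ρ, L ρ = gkslForm F H γ ρ) (h' : ∀ ρ, L ρ = gkslForm F' H' γ' ρ) :
    tracelessCompression (coeffOperator F γ) = tracelessCompression (coeffOperator F' γ') := by
  obtain ⟨K, K', hK⟩ := reshuffle_eq_of_eq_gkslForm h
  obtain ⟨J, J', hJ⟩ := reshuffle_eq_of_eq_gkslForm h'
  have key {G : MatN N →ₗ[ℂ] MatN N} {K K' : MatN N} (x y : traceless N)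
      (hG : reshuffle N L = G + ketbra K 1 + ketbra 1 K') :
      inner ℂ x (tracelessCompression G y) = inner ℂ (x : MatN N) (reshuffle N L y) := by
    rw [inner_tracelessCompression, hG]
    simp [ketbra_apply, inner_one_left, inner_one_right,
      mem_traceless.1 x.2, mem_traceless.1 y.2]
  refine LinearMap.ext fun y => ext_inner_left ℂ fun x => ?_
  rw [key x y hK, key x y hJ]

/-! ### Generators have a GKSL representation -/

theorem tendsto_inner_reshuffle {N : ℕ} {L : MatN N →ₗ[ℂ] MatN N}
    {T : ℝ≥0 → (MatN N →ₗ[ℂ] MatN N)} (hL : IsGeneratorOf L T) (X Y : MatN N) :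
    Filter.Tendsto (fun t : ℝ≥0 => (((t : ℝ)⁻¹ : ℝ) : ℂ) *
        (inner ℂ X (reshuffle N (T t) Y) - inner ℂ X (ketbra (1 : MatN N) 1 Y)))
      (𝓝[>] (0 : ℝ≥0)) (𝓝 (inner ℂ X (reshuffle N L Y))) := by
  have e (t : ℝ≥0) : (((t : ℝ)⁻¹ : ℝ) : ℂ) *
      (inner ℂ X (reshuffle N (T t) Y) - inner ℂ X (ketbra (1 : MatN N) 1 Y)) =
      inner ℂ X (reshuffle N ((((t : ℝ)⁻¹ : ℝ) : ℂ) • (T t - LinearMap.id)) Y) := by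
    rw [map_smul, map_sub, ← reshuffle_ketbra_one_one, reshuffle_reshuffle,
      LinearMap.smul_apply, LinearMap.sub_apply, inner_smul_right, inner_sub_right]
  simp only [e]
  simp only [inner_reshuffle]
  refine tendsto_finsetSum _ fun a _ => tendsto_finsetSum _ fun k _ => ?_
  refine tendsto_const_nhds.mul (tendsto_finsetSum _ fun p _ => tendsto_finsetSum _ fun q _ => ?_)
  refine Filter.Tendsto.mul ?_ tendsto_const_nhds
  exact tendsto_pi_nhds.1 (tendsto_pi_nhds.1 (hL (Matrix.single k q 1)) a) p

theorem IsQDSGenerator.reshuffle_isSymmetric {N : ℕ} {L : MatN N →ₗ[ℂ] MatN N}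
    (h : IsQDSGenerator L) : (reshuffle N L).IsSymmetric := by
  obtain ⟨T, hT, hL⟩ := h
  intro X Y
  rw [← inner_conj_symm]
  refine tendsto_nhds_unique
    ((Complex.continuous_conj.tendsto _).comp (tendsto_inner_reshuffle hL Y X))
    ((tendsto_inner_reshuffle hL X Y).congr fun t => ?_)
  simp only [Function.comp_apply, map_mul, map_sub, Complex.conj_ofReal, inner_conj_symm]
  rw [(hT.completelyPositive t).reshuffle_isPositive.isSymmetric,
    (ketbra_self_isPositive (1 : MatN N)).isSymmetric]

theorem IsQDSGenerator.inner_reshuffle_nonneg {N : ℕ} {L : MatN N →ₗ[ℂ] MatN N}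
    (h : IsQDSGenerator L) {Y : MatN N} (hY : Y.trace = 0) :
    0 ≤ inner ℂ Y (reshuffle N L Y) := by
  obtain ⟨T, hT, hL⟩ := h
  refine ge_of_tendsto' (tendsto_inner_reshuffle hL Y Y) fun t => ?_
  refine mul_nonneg (by exact_mod_cast inv_nonneg.2 t.2) ?_
  rw [ketbra_apply, inner_one_left, hY, zero_smul, inner_zero_right, sub_zero]
  exact (hT.completelyPositive t).reshuffle_isPositive.inner_nonneg_right Y

theorem IsQDSGenerator.trace_eq_zero {N : ℕ} {L : MatN N →ₗ[ℂ] MatN N}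
    (h : IsQDSGenerator L) (A : MatN N) : (L A).trace = 0 := by
  obtain ⟨T, hT, hL⟩ := h
  have h1 := tendsto_finsetSum Finset.univ fun a (_ : a ∈ (Finset.univ : Finset (Fin N))) =>
    tendsto_pi_nhds.1 (tendsto_pi_nhds.1 (hL A) a) a
  refine tendsto_nhds_unique (h1.congr fun t => ?_) tendsto_const_nhds
  change (((t : ℝ)⁻¹ : ℝ) • (T t A - A)).trace = 0
  rw [Matrix.trace_smul, Matrix.trace_sub, hT.trace_preserving, sub_self, smul_zero]

theorem contraction_reshuffle_eq_zero {N : ℕ} {L : MatN N →ₗ[ℂ] MatN N}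
    (h : ∀ A, (L A).trace = 0) : contraction N (reshuffle N L) = 0 := by
  rw [Matrix.ext_iff_trace_mul_right]
  intro ρ
  rw [← trace_reshuffle, reshuffle_reshuffle, h, zero_mul, Matrix.trace_zero]

theorem IsQDSGenerator.exists_representation {N : ℕ} {F : Fin (N ^ 2) → MatN N}
    (hF : Orthonormal ℂ F) {L : MatN N →ₗ[ℂ] MatN N} (h : IsQDSGenerator L) :
    ∃ H γ, IsGKSLRepresentation F L H γ := by
  obtain ⟨γ, hγ⟩ := exists_eq_coeffOperator hF (reshuffle N L)
  -- No Hamiltonian is needed: the coefficient operator R(L) has zero contraction, so the form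
  -- reduces to R(R(L)) = L.
  refine ⟨0, γ, Matrix.isHermitian_zero, fun ρ => ?_, ?_⟩
  · rw [gkslForm_eq, ← hγ, contraction_reshuffle_eq_zero h.trace_eq_zero, reshuffle_reshuffle]
    simp
  · rw [← hγ]
    exact isAdmissible_of_isSymmetric h.reshuffle_isSymmetric fun Y => h.inner_reshuffle_nonneg

/-! ### Reduction of an admissible operator to a positive one -/

/-- Here Tr(B²) = 2 Re Tr(wB), which is the squared norm of B. -/
theorem eq_zero_of_re_trace_mul_eq_zero {N : ℕ} {B : MatN N} (hB : B.IsHermitian) {w : MatN N}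
    (hw : B = w + w.conjTranspose) (h : (w * B).trace.re = 0) : B = 0 := by
  have h2 : (w.conjTranspose * B).trace = star (w * B).trace := by
    rw [← Matrix.trace_conjTranspose, Matrix.conjTranspose_mul, hB.eq, Matrix.trace_mul_comm]
  have h3 : inner ℂ B B = (w * B).trace + star (w * B).trace := by
    rw [hilbertSchmidt_inner_def, hB.eq, ← h2, ← Matrix.trace_add, ← add_mul, ← hw]
  rw [← inner_self_eq_zero (𝕜 := ℂ), h3]
  apply Complex.ext <;> simp [h]

/-- Up to a Hamiltonian term, an admissible coefficient operator may be replaced by a positive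
one. -/
theorem IsAdmissible.exists_isPositive {N : ℕ} {G : Module.End ℂ (MatN N)}
    (hG : IsAdmissible G) :
    ∃ (A : Module.End ℂ (MatN N)) (w : MatN N), A.IsPositive ∧ w.conjTranspose = -w ∧
      ∀ ρ, reshuffle N G ρ - (1 / 2 : ℂ) • (contraction N G * ρ + ρ * contraction N G) =
        reshuffle N A ρ - (1 / 2 : ℂ) • (contraction N A * ρ + ρ * contraction N A) +
          (1 / 2 : ℂ) • (w * ρ - ρ * w) := by
  rcases Nat.eq_zero_or_pos N with rfl | hN
  · exact ⟨0, 0, LinearMap.isPositive_zero, Subsingleton.elim _ _,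
      fun ρ => Subsingleton.elim _ _⟩
  have hN' : (N : ℂ) ≠ 0 := by exact_mod_cast hN.ne'
  -- The orthogonal projection onto traceless matrices; ‖1‖² = N gives the constant.
  let P : Module.End ℂ (MatN N) := LinearMap.id - (N : ℂ)⁻¹ • ketbra 1 1
  have hPapply (X : MatN N) : P X = X - ((N : ℂ)⁻¹ * X.trace) • 1 := by
    simp [P, ketbra_apply, inner_one_left, smul_smul]
  have hPtr (X : MatN N) : (P X).trace = 0 := by
    rw [hPapply]
    simp only [Matrix.trace_sub, Matrix.trace_smul, Matrix.trace_one, Fintype.card_fin, smul_eq_mul]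
    field_simp
    ring
  have hPin (X Y : MatN N) : inner ℂ X (P Y) = inner ℂ (P X) (P Y) := by
    conv_rhs => rw [hPapply X]
    rw [inner_sub_left, inner_smul_left, inner_one_left, hPtr, mul_zero, sub_zero]
  let u : MatN N := (N : ℂ)⁻¹ • G 1
  let v : MatN N := (N : ℂ)⁻¹ • LinearMap.adjoint G 1
  have hv (X : MatN N) : inner ℂ v X = (N : ℂ)⁻¹ * (G X).trace := by
    simp [v, LinearMap.adjoint_inner_left, inner_one_left, mul_comm]
  let A : Module.End ℂ (MatN N) := P ∘ₗ G ∘ₗ P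
  let α : ℂ := (N : ℂ)⁻¹ * ((N : ℂ)⁻¹ * (G 1).trace)
  -- Expansion of P G P. In the dissipator |1⟩⟨1| contributes zero, |u⟩⟨1| gives ½[u, ρ] and |1⟩⟨v|
  -- gives -½[v^*, ρ].
  have hGA : G = A + ketbra u 1 + ketbra 1 v - α • ketbra 1 1 := by
    ext1 X
    simp only [A, LinearMap.add_apply, LinearMap.sub_apply, LinearMap.smul_apply, ketbra_apply,
      LinearMap.comp_apply, inner_one_left, hv, u, α]
    rw [hPapply, hPapply, map_sub, map_smul, Matrix.trace_sub, Matrix.trace_smul, smul_eq_mul]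
    module
  -- Condition 2 says Re Tr(wB) = 0 for Hermitian B; B = w + w^* forces B = 0.
  have hskew : (u - v.conjTranspose).conjTranspose = -(u - v.conjTranspose) := by
    set w := u - v.conjTranspose with hw
    have hH : (w + w.conjTranspose).IsHermitian := Matrix.isHermitian_add_transpose_self w
    have h0 := hG.re_trace_eq _ hH
    have h1 : (N : ℂ) * (w * (w + w.conjTranspose)).trace =
        (G 1 * (w + w.conjTranspose)).trace - (G (w + w.conjTranspose)).trace := by
      have := hv (w + w.conjTranspose)
      rw [hilbertSchmidt_inner_def] at this
      conv_lhs => rw [hw, sub_mul, Matrix.trace_sub, ← hw, this]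
      simp only [u, Matrix.smul_mul, Matrix.trace_smul, smul_eq_mul]
      field_simp
    have h2 : (w * (w + w.conjTranspose)).trace.re = 0 := by
      have := congrArg Complex.re h1
      rw [Complex.sub_re, h0, sub_self, ← Complex.ofReal_natCast, Complex.re_ofReal_mul] at this
      exact (mul_eq_zero.1 this).resolve_left (by exact_mod_cast hN.ne')
    exact eq_neg_of_add_eq_zero_right (eq_zero_of_re_trace_mul_eq_zero hH rfl h2)
  refine ⟨A, u - v.conjTranspose, isPositive_of_inner_nonneg fun Y => ?_, hskew, fun ρ => ?_⟩
  · simp only [A, LinearMap.comp_apply]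
    have h := tracelessCompression_isPositive_iff.1 hG.compression_nonneg (P Y) (hPtr Y)
    rw [hPin, hPapply (G (P Y)), inner_sub_right, inner_smul_right, inner_one_right, hPtr]
    simpa using h
  · conv_lhs => rw [hGA]
    simp only [map_add, map_sub, map_smul, LinearMap.add_apply, LinearMap.sub_apply,
      LinearMap.smul_apply, reshuffle_ketbra_apply, contraction_ketbra, Matrix.conjTranspose_one,
      mul_one, one_mul, sub_mul, mul_sub, add_mul, mul_add, Matrix.smul_mul, Matrix.mul_smul]
    module

/-- A map in GKSL form is the sum of a completely positive map and a map `ρ ↦ K ρ + ρ K^*`. -/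
theorem IsGKSLRepresentation.exists_dissipation {N : ℕ} {F : Fin (N ^ 2) → MatN N}
    {L : MatN N →ₗ[ℂ] MatN N} {H : MatN N} {γ : Matrix (Fin (N ^ 2)) (Fin (N ^ 2)) ℂ}
    (h : IsGKSLRepresentation F L H γ) :
    ∃ (A : Module.End ℂ (MatN N)) (K : MatN N), A.IsPositive ∧
      L = reshuffle N A + reshuffle N (ketbra K 1) + reshuffle N (ketbra 1 K) := by
  obtain ⟨A, w, hA, hw, hG⟩ := h.admissible.exists_isPositive
  refine ⟨A, -Complex.I • H + (1 / 2 : ℂ) • w - (1 / 2 : ℂ) • contraction N A, hA, ?_⟩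
  ext1 ρ
  rw [h.eq_form, gkslForm_eq, add_sub_assoc, hG]
  simp only [LinearMap.add_apply, reshuffle_ketbra_apply, Matrix.conjTranspose_one,
    Matrix.conjTranspose_sub, Matrix.conjTranspose_add, Matrix.conjTranspose_smul, hw,
    (contraction_isHermitian hA.isSymmetric).eq, h.hermitian.eq, mul_one, one_mul, sub_mul,
    mul_sub, add_mul, mul_add, Matrix.smul_mul, Matrix.mul_smul, mul_neg]
  simp
  module

theorem IsGKSLRepresentation.trace_eq_zero {N : ℕ} {F : Fin (N ^ 2) → MatN N}
    {L : MatN N →ₗ[ℂ] MatN N} {H : MatN N} {γ : Matrix (Fin (N ^ 2)) (Fin (N ^ 2)) ℂ}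
    (h : IsGKSLRepresentation F L H γ) (ρ : MatN N) : (L ρ).trace = 0 := by
  rw [h.eq_form, gkslForm_eq, Matrix.trace_sub, Matrix.trace_add, trace_reshuffle,
    Matrix.trace_smul, Matrix.trace_smul, Matrix.trace_sub, Matrix.trace_add,
    Matrix.trace_mul_comm H, Matrix.trace_mul_comm ρ (contraction _ _)]
  simp only [smul_eq_mul]
  ring

/-! ### Exponentials and the generated semigroup -/

/-- The Banach algebra of operators on the entries of matrices. -/
abbrev EntryAlgebra (N : ℕ) : Type :=
  (Fin N → Fin N → ℂ) →L[ℂ] (Fin N → Fin N → ℂ)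

/-- Operators on `M_N(ℂ)` as elements of a Banach algebra. -/
noncomputable def entryAlgEquiv (N : ℕ) : Module.End ℂ (MatN N) ≃ₐ[ℂ] EntryAlgebra N :=
  ((Matrix.ofLinearEquiv ℂ).symm.conjAlgEquiv ℂ).trans
    (Module.End.toContinuousLinearMap (𝕜 := ℂ) (Fin N → Fin N → ℂ))

noncomputable instance (N : ℕ) : NormedAlgebra ℚ (EntryAlgebra N) :=
  NormedAlgebra.restrictScalars ℚ ℂ _

theorem isClosed_setOf_isCompletelyPositive (N : ℕ) :
    IsClosed {x : EntryAlgebra N | IsCompletelyPositive ((entryAlgEquiv N).symm x)} := by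
  have h : {x : EntryAlgebra N | IsCompletelyPositive ((entryAlgEquiv N).symm x)} =
      ⋂ Y : MatN N, {x | 0 ≤ inner ℂ Y (reshuffle N ((entryAlgEquiv N).symm x) Y)} := by
    ext x
    simp only [Set.mem_ofPred_eq, Set.mem_iInter]
    rw [isCompletelyPositive_iff]
    exact ⟨fun h Y => h.inner_nonneg_right Y, isPositive_of_inner_nonneg⟩
  rw [h]
  refine isClosed_iInter fun Y => isClosed_le continuous_const ?_
  let f : EntryAlgebra N →ₗ[ℂ] ℂ := (innerₛₗ ℂ Y : MatN N →ₗ[ℂ] ℂ) ∘ₗ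
    LinearMap.applyₗ Y ∘ₗ reshuffle N ∘ₗ (entryAlgEquiv N).symm.toLinearMap
  exact f.continuous_of_finiteDimensional

/-- The partial sums are nonnegative combinations of powers of T, and the completely positive maps
form a closed set. -/
theorem isCompletelyPositive_exp {N : ℕ} {T : Module.End ℂ (MatN N)}
    (hT : IsCompletelyPositive T) :
    IsCompletelyPositive ((entryAlgEquiv N).symm (NormedSpace.exp (entryAlgEquiv N T))) := by
  refine (isClosed_setOf_isCompletelyPositive N).mem_of_tendsto
    (NormedSpace.exp_series_hasSum_exp' (𝕂 := ℂ) (entryAlgEquiv N T)) (.of_forall fun s => ?_)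
  simp only [Set.mem_ofPred_eq, map_sum, map_smul, map_pow, AlgEquiv.symm_apply_apply]
  exact .sum s fun n _ => (hT.pow n).smul (inv_nonneg.2 (Nat.cast_nonneg _))

/-- The exponential of a map of the form `Φ(ρ) + K ρ + ρ K^*` with `Φ` completely positive is
completely positive: with `S = s Φ + (1 + s K) · (1 + s K)^*`, it is the limit of
`exp ((S - id) / s)` as `s ↓ 0`. -/
theorem isCompletelyPositive_exp_of_dissipation {N : ℕ} {A : Module.End ℂ (MatN N)}
    (hA : A.IsPositive) (K : MatN N) :
    IsCompletelyPositive ((entryAlgEquiv N).symm (NormedSpace.exp (entryAlgEquiv N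
      (reshuffle N A + reshuffle N (ketbra K 1) + reshuffle N (ketbra 1 K))))) := by
  set L := reshuffle N A + reshuffle N (ketbra K 1) + reshuffle N (ketbra 1 K) with hL
  let Q := reshuffle N (ketbra K K)
  -- The term s K ρ K^* completes the square: s⁻¹ (1 + sK) ρ (1 + sK)^* = s⁻¹ ρ + Kρ + ρK^* + s K ρ
  -- K^*.
  let f : ℝ → EntryAlgebra N := fun s => entryAlgEquiv N L + (s : ℂ) • entryAlgEquiv N Q
  have hf0 : f 0 = entryAlgEquiv N L := by
    simp only [f, Complex.ofReal_zero]
    exact (congrArg _ (zero_smul ℂ (entryAlgEquiv N Q))).trans (add_zero _)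
  have hf : Filter.Tendsto (fun s => NormedSpace.exp (f s)) (𝓝[>] 0)
      (𝓝 (NormedSpace.exp (entryAlgEquiv N L))) := by
    have hc : Continuous fun s => NormedSpace.exp (f s) :=
      NormedSpace.exp_continuous.comp (by fun_prop)
    have := hc.tendsto 0
    rw [hf0] at this
    exact this.mono_left nhdsWithin_le_nhds
  refine (isClosed_setOf_isCompletelyPositive N).mem_of_tendsto hf ?_
  filter_upwards [self_mem_nhdsWithin] with s (hs : 0 < s)
  have hs' : (s : ℂ) ≠ 0 := by exact_mod_cast hs.ne'
  let S : Module.End ℂ (MatN N) :=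
    reshuffle N A + ((s⁻¹ : ℝ) : ℂ) • reshuffle N (ketbra (1 + (s : ℂ) • K) (1 + (s : ℂ) • K))
  have hS : IsCompletelyPositive S := (isCompletelyPositive_reshuffle hA).add
    ((isCompletelyPositive_reshuffle_ketbra _).smul (by exact_mod_cast (inv_pos.2 hs).le))
  have hfS : f s = algebraMap ℝ (EntryAlgebra N) (-s⁻¹) + entryAlgEquiv N S := by
    have : L + (s : ℂ) • Q = ((-s⁻¹ : ℝ) : ℂ) • LinearMap.id + S := by
      ext1 ρ
      simp only [hL, Q, S, LinearMap.add_apply, LinearMap.smul_apply, reshuffle_ketbra_apply,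
        Matrix.conjTranspose_add, Matrix.conjTranspose_smul, Matrix.conjTranspose_one, add_mul,
        mul_add, mul_one, one_mul, Matrix.smul_mul, Matrix.mul_smul, LinearMap.id_apply,
        smul_add, smul_smul, Complex.ofReal_inv, Complex.ofReal_neg, inv_mul_cancel₀ hs',
        RCLike.star_def, Complex.conj_ofReal, one_smul, inv_mul_cancel_left₀ hs']
      module
    simp only [f]
    rw [← map_smul, ← map_add, this, map_add, map_smul]
    congr 1
  -- The scalar summand -s⁻¹ only contributes the positive factor exp(-s⁻¹).
  rw [hfS, NormedSpace.exp_add_of_commute (Algebra.commutes _ _),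
    ← NormedSpace.algebraMap_exp_comm, ← Real.exp_eq_exp_ℝ, ← Algebra.smul_def]
  have : Real.exp (-s⁻¹) • NormedSpace.exp (entryAlgEquiv N S) =
      (Real.exp (-s⁻¹) : ℂ) • NormedSpace.exp (entryAlgEquiv N S) := rfl
  rw [this, map_smul]
  exact (isCompletelyPositive_exp hS).smul (by exact_mod_cast (Real.exp_pos _).le)

/-- The semigroup generated by an operator on `M_N(ℂ)`. -/
noncomputable def expSemigroup {N : ℕ} (L : MatN N →ₗ[ℂ] MatN N) (t : ℝ≥0) :
    MatN N →ₗ[ℂ] MatN N :=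
  (entryAlgEquiv N).symm (NormedSpace.exp ((t : ℝ) • entryAlgEquiv N L))

theorem expSemigroup_eq {N : ℕ} (L : MatN N →ₗ[ℂ] MatN N) (t : ℝ≥0) :
    expSemigroup L t =
      (entryAlgEquiv N).symm (NormedSpace.exp (entryAlgEquiv N (((t : ℝ) : ℂ) • L))) := by
  rw [map_smul]
  rfl

/-- Only the zeroth term of the exponential series survives the trace, since every other term lies
in the range of L. -/
theorem trace_expSemigroup {N : ℕ} {L : MatN N →ₗ[ℂ] MatN N} (h : ∀ ρ, (L ρ).trace = 0)
    (t : ℝ≥0) (A : MatN N) : (expSemigroup L t A).trace = A.trace := by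
  let f : EntryAlgebra N →ₗ[ℂ] ℂ := Matrix.traceLinearMap (Fin N) ℂ ℂ ∘ₗ
    LinearMap.applyₗ A ∘ₗ (entryAlgEquiv N).symm.toLinearMap
  have hs := (NormedSpace.exp_series_hasSum_exp' (𝕂 := ℂ)
    (entryAlgEquiv N (((t : ℝ) : ℂ) • L))).map f f.continuous_of_finiteDimensional
  have h0 : ∀ n ≠ 0, (f ∘ fun n : ℕ => ((n.factorial : ℂ)⁻¹) •
      (entryAlgEquiv N (((t : ℝ) : ℂ) • L)) ^ n) n = 0 := by
    intro n hn
    obtain ⟨m, rfl⟩ := Nat.exists_eq_succ_of_ne_zero hn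
    rw [Function.comp_apply, map_smul, ← map_pow]
    have : f (entryAlgEquiv N ((((t : ℝ) : ℂ) • L) ^ (m + 1))) =
        ((((t : ℝ) : ℂ) • L) (((((t : ℝ) : ℂ) • L) ^ m : Module.End ℂ (MatN N)) A)).trace := by
      rw [pow_succ']
      rfl
    rw [this, LinearMap.smul_apply, Matrix.trace_smul, h, smul_zero, smul_zero]
  have h1 := hs.unique (hasSum_single 0 h0)
  rw [expSemigroup_eq]
  refine h1.trans ?_
  simp [f]

theorem isGeneratorOf_expSemigroup {N : ℕ} (L : MatN N →ₗ[ℂ] MatN N) :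
    IsGeneratorOf L (expSemigroup L) := by
  intro A
  refine tendsto_pi_nhds.2 fun a => tendsto_pi_nhds.2 fun b => ?_
  have h0 := (hasDerivAt_exp_smul_const (𝕂 := ℝ) (entryAlgEquiv N L) 0).tendsto_slope_zero_right
  rw [zero_smul, NormedSpace.exp_zero, one_mul] at h0
  have hc : Filter.Tendsto ((↑) : ℝ≥0 → ℝ) (𝓝[>] 0) (𝓝[>] 0) :=
    tendsto_nhdsWithin_of_tendsto_nhds_of_eventually_within _
      ((NNReal.continuous_coe.tendsto 0).mono_left nhdsWithin_le_nhds)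
      (by filter_upwards [self_mem_nhdsWithin] with t (ht : 0 < t) using ht)
  have he : Continuous fun x : EntryAlgebra N => x (fun i j => A i j) a b := by fun_prop
  refine ((he.tendsto _).comp (h0.comp hc)).congr fun t => ?_
  rw [Function.comp_apply, Function.comp_apply, zero_add]
  rfl

theorem continuous_expSemigroup {N : ℕ} (L : MatN N →ₗ[ℂ] MatN N) (A : MatN N) :
    Continuous fun t : ℝ≥0 => expSemigroup L t A := by
  refine continuous_pi fun a => continuous_pi fun b => ?_
  have he : Continuous fun x : EntryAlgebra N => x (fun i j => A i j) a b := by fun_prop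
  exact he.comp (NormedSpace.exp_continuous.comp (by fun_prop))

theorem expSemigroup_zero {N : ℕ} (L : MatN N →ₗ[ℂ] MatN N) :
    expSemigroup L 0 = LinearMap.id := by
  have h : (((0 : ℝ≥0) : ℝ) • entryAlgEquiv N L) = 0 := zero_smul ℝ (entryAlgEquiv N L)
  rw [expSemigroup, h, NormedSpace.exp_zero]
  exact map_one _

theorem expSemigroup_add {N : ℕ} (L : MatN N →ₗ[ℂ] MatN N) (t s : ℝ≥0) :
    expSemigroup L (t + s) = expSemigroup L t ∘ₗ expSemigroup L s := by
  have h : (((t + s : ℝ≥0) : ℝ) : ℂ) • L = ((t : ℝ) : ℂ) • L + ((s : ℝ) : ℂ) • L := by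
    rw [NNReal.coe_add, Complex.ofReal_add, add_smul]
  have hc : Commute (S := Module.End ℂ (MatN N)) (((t : ℝ) : ℂ) • L) (((s : ℝ) : ℂ) • L) :=
    ((Commute.refl (S := Module.End ℂ (MatN N)) L).smul_left _).smul_right _
  rw [expSemigroup_eq, expSemigroup_eq, expSemigroup_eq, h, map_add,
    NormedSpace.exp_add_of_commute (hc.map (entryAlgEquiv N))]
  exact map_mul _ _ _

theorem IsGKSLRepresentation.isQDSGenerator {N : ℕ} {F : Fin (N ^ 2) → MatN N}
    {L : MatN N →ₗ[ℂ] MatN N} {H : MatN N} {γ : Matrix (Fin (N ^ 2)) (Fin (N ^ 2)) ℂ}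
    (h : IsGKSLRepresentation F L H γ) : IsQDSGenerator L := by
  refine ⟨expSemigroup L, ⟨expSemigroup_zero L, expSemigroup_add L, continuous_expSemigroup L,
    trace_expSemigroup h.trace_eq_zero, fun t => ?_⟩, isGeneratorOf_expSemigroup L⟩
  obtain ⟨A, K, hA, hL⟩ := h.exists_dissipation
  -- As t is real, scaling keeps the shape Φ(ρ) + Kρ + ρK^*.
  have ht : ((t : ℝ) : ℂ) • L = reshuffle N (((t : ℝ) : ℂ) • A) +
      reshuffle N (ketbra (((t : ℝ) : ℂ) • K) 1) + reshuffle N (ketbra 1 (((t : ℝ) : ℂ) • K)) := by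
    rw [hL]
    ext1 ρ
    simp [reshuffle_ketbra_apply]
  rw [expSemigroup_eq, ht]
  exact isCompletelyPositive_exp_of_dissipation
    (hA.smul_of_nonneg (by exact_mod_cast t.2)) _

theorem mainTheorem5 (N : ℕ) (F : Fin (N ^ 2) → MatN N) (hF : Orthonormal ℂ F) :
    (∀ L : MatN N →ₗ[ℂ] MatN N,
      IsQDSGenerator L ↔
        ∃ (H : MatN N) (γ : Matrix (Fin (N ^ 2)) (Fin (N ^ 2)) ℂ),
          IsGKSLRepresentation F L H γ) ∧
    (∀ (L : MatN N →ₗ[ℂ] MatN N) (F' : Fin (N ^ 2) → MatN N), Orthonormal ℂ F' →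
      ∀ (H H' : MatN N) (γ γ' : Matrix (Fin (N ^ 2)) (Fin (N ^ 2)) ℂ),
        IsGKSLRepresentation F L H γ → IsGKSLRepresentation F' L H' γ' →
          tracelessCompression (coeffOperator F γ) =
            tracelessCompression (coeffOperator F' γ')) ∧
    (∀ γ : Matrix (Fin (N ^ 2)) (Fin (N ^ 2)) ℂ,
      γ.PosSemidef → IsAdmissible (coeffOperator F γ)) :=
  ⟨fun _ => ⟨fun h => h.exists_representation hF, fun ⟨_, _, h⟩ => h.isQDSGenerator⟩,
    fun _ _ _ _ _ _ _ h h' => tracelessCompression_unique h.eq_form h'.eq_form,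
    fun _ => IsAdmissible.of_posSemidef F⟩
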